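/- Let $\mathcal H_{\mathrm A},\mathcal H_{\mathrm B_1},\mathcal H_{\mathrm B_2}$ be finite-dimensional complex Hilbert spaces. A channel $\mathrm A\to\mathrm B$ is a completely positive trace-preserving linear map from the operators on $\mathcal H_{\mathrm A}$ to the operators on $\mathcal H_{\mathrm B}$. For channels $\Phi,\Psi:\mathrm A\to\mathrm B$ put $$\|\Phi-\Psi\|_\diamond:=\sup_{n\in\mathbb N}\ \sup_{\rho}\ \big\|(\Phi\otimes\mathrm{id}_n)(\rho)-(\Psi\otimes\mathrm{id}_n)(\rho)\big\|_1,$$ where $\rho$ runs over the density operators on $\mathcal H_{\mathrm A}\otimes\mathbb C^n$ and $\|X\|_1=\mathrm{Tr}\sqrt{X^\dagger X}$. A pair of channels $\Lambda:\mathrm A\to\mathrm B_1$, $\Xi:\mathrm A\to\mathrm B_2$ is compatible if there is a channel $\Theta:\mathrm A\to\mathrm B_1\mathrm B_2$ (with output space $\mathcal H_{\mathrm B_1}\otimes\mathcal H_{\mathrm B_2}$) such that $\mathrm{Tr}_{\mathrm B_2}\circ\Theta=\Lambda$ and $\mathrm{Tr}_{\mathrm B_1}\circ\Theta=\Xi$.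 The generalized robustness of incompatibility of a pair of channels $(\Lambda,\Xi)$ is $$R(\Lambda,\Xi):=\min\Big\{r\ge 0\ \Big|\ \text{there are channels } N_i:\mathrm A\to\mathrm B_i\ (i=1,2)\text{ such that }\Big(\tfrac{\Lambda+rN_1}{1+r},\tfrac{\Xi+rN_2}{1+r}\Big)\text{ is compatible}\Big\}.$$ Theorem. Let $\Lambda:\mathrm A\to\mathrm B_1$ and $\Xi:\mathrm A\to\mathrm B_2$ be channels. Then the minimum defining $R(\Lambda,\Xi)$ is attained, and for any channel $\Theta:\mathrm A\to\mathrm B_1\mathrm B_2$ with marginals $\Theta^{(1)}=\mathrm{Tr}_{\mathrm B_2}\circ\Theta$ and $\Theta^{(2)}=\mathrm{Tr}_{\mathrm B_1}\circ\Theta$, $$2R(\Lambda,\Xi)\le\|\Lambda-\Theta^{(1)}\|_\diamond+\|\Xi-\Theta^{(2)}\|_\diamond .$$ -/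

import Mathlib

open scoped Kronecker ComplexOrder

namespace QChannel

/-! Finite-dimensional quantum systems: a system with Hilbert space `ℂ^a` is given by a finite
index type `a`, operators on it are the matrices `Matrix a a ℂ`, and the composite of `a` and `b`
is indexed by `a × b`. -/

variable {a b c : Type*}

/-- The map `Φ ⊗ id` on operators of `ℂ^a ⊗ ℂ^c`: `Φ` acts on each block of the first factor. -/
def ampliate (c : Type*) (Φ : Matrix a a ℂ →ₗ[ℂ] Matrix b b ℂ) :
    Matrix (a × c) (a × c) ℂ →ₗ[ℂ] Matrix (b × c) (b × c) ℂ where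
  toFun M := Matrix.of fun p q => Φ (Matrix.of fun x y => M (x, p.2) (y, q.2)) p.1 q.1
  map_add' M N := by
    ext p q
    exact congrFun (congrFun (Φ.map_add (Matrix.of fun x y => M (x, p.2) (y, q.2))
      (Matrix.of fun x y => N (x, p.2) (y, q.2))) p.1) q.1
  map_smul' t M := by
    ext p q
    exact congrFun (congrFun (Φ.map_smul t (Matrix.of fun x y => M (x, p.2) (y, q.2))) p.1) q.1

/-- The defining property of `Φ ⊗ id` on product operators. -/
theorem ampliate_kronecker (Φ : Matrix a a ℂ →ₗ[ℂ] Matrix b b ℂ) (X : Matrix a a ℂ)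
    (Y : Matrix c c ℂ) : ampliate c Φ (X ⊗ₖ Y) = Φ X ⊗ₖ Y := by
  ext p q
  have h : (Matrix.of fun x y => (X ⊗ₖ Y) (x, p.2) (y, q.2)) = Y p.2 q.2 • X := by
    ext x y
    simp [mul_comm]
  simp only [ampliate, LinearMap.coe_mk, AddHom.coe_mk, Matrix.of_apply, h, map_smul]
  simp [mul_comm]

/-- A completely positive and trace-preserving linear map. -/
structure IsChannel [Fintype a] [Fintype b] (Φ : Matrix a a ℂ →ₗ[ℂ] Matrix b b ℂ) : Prop where
  completelyPositive : ∀ (n : ℕ) (M : Matrix (a × Fin n) (a × Fin n) ℂ),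
    M.PosSemidef → (ampliate (Fin n) Φ M).PosSemidef
  tracePreserving : ∀ X : Matrix a a ℂ, (Φ X).trace = X.trace

/-- The partial trace over the second factor. -/
def traceSnd (b c : Type*) [Fintype c] : Matrix (b × c) (b × c) ℂ →ₗ[ℂ] Matrix b b ℂ where
  toFun M := Matrix.of fun i j => ∑ k, M (i, k) (j, k)
  map_add' M N := by
    ext i j
    simp [Finset.sum_add_distrib]
  map_smul' t M := by
    ext i j
    simp [Finset.mul_sum]

/-- The partial trace over the first factor. -/
def traceFst (b c : Type*) [Fintype b] : Matrix (b × c) (b × c) ℂ →ₗ[ℂ] Matrix c c ℂ where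
  toFun M := Matrix.of fun i j => ∑ k, M (k, i) (k, j)
  map_add' M N := by
    ext i j
    simp [Finset.sum_add_distrib]
  map_smul' t M := by
    ext i j
    simp [Finset.mul_sum]

/-- Two maps with the same input are compatible if they are the marginals of a joint channel. -/
def Compatible [Fintype a] [Fintype b] [Fintype c] (Φ : Matrix a a ℂ →ₗ[ℂ] Matrix b b ℂ)
    (Ψ : Matrix a a ℂ →ₗ[ℂ] Matrix c c ℂ) : Prop :=
  ∃ Θ : Matrix a a ℂ →ₗ[ℂ] Matrix (b × c) (b × c) ℂ,
    IsChannel Θ ∧ traceSnd b c ∘ₗ Θ = Φ ∧ traceFst b c ∘ₗ Θ = Ψ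

/-- The noise levels `r ≥ 0` at which mixing with some noise channels makes the pair compatible. -/
def noiseLevels [Fintype a] [Fintype b] [Fintype c] (Λ : Matrix a a ℂ →ₗ[ℂ] Matrix b b ℂ)
    (Ξ : Matrix a a ℂ →ₗ[ℂ] Matrix c c ℂ) : Set ℝ :=
  {r | 0 ≤ r ∧ ∃ (N₁ : Matrix a a ℂ →ₗ[ℂ] Matrix b b ℂ) (N₂ : Matrix a a ℂ →ₗ[ℂ] Matrix c c ℂ),
    IsChannel N₁ ∧ IsChannel N₂ ∧
      Compatible ((1 + r : ℂ)⁻¹ • (Λ + (r : ℂ) • N₁)) ((1 + r : ℂ)⁻¹ • (Ξ + (r : ℂ) • N₂))}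

/-- The generalized robustness of incompatibility of a pair of channels. -/
noncomputable def robustness [Fintype a] [Fintype b] [Fintype c]
    (Λ : Matrix a a ℂ →ₗ[ℂ] Matrix b b ℂ) (Ξ : Matrix a a ℂ →ₗ[ℂ] Matrix c c ℂ) : ℝ :=
  sInf (noiseLevels Λ Ξ)

/-- Density operators. -/
def IsState [Fintype a] (ρ : Matrix a a ℂ) : Prop :=
  ρ.PosSemidef ∧ ρ.trace = 1

/-- The trace norm `Tr √(Xᴴ X)`, the sum of the singular values of `X`. -/
noncomputable def traceNorm [Fintype a] [DecidableEq a] (X : Matrix a a ℂ) : ℝ :=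
  ∑ i, √((Matrix.isHermitian_conjTranspose_mul_self X).eigenvalues i)

/-- The diamond norm distance of two channels: the supremum, over all `n` and all states `ρ` of
`ℂ^a ⊗ ℂ^n`, of the trace norm of `(Φ ⊗ id)(ρ) - (Ψ ⊗ id)(ρ)`. -/
noncomputable def diamondDist [Fintype a] [Fintype b] [DecidableEq b]
    (Φ Ψ : Matrix a a ℂ →ₗ[ℂ] Matrix b b ℂ) : ℝ :=
  sSup {t | ∃ (n : ℕ) (ρ : Matrix (a × Fin n) (a × Fin n) ℂ), IsState ρ ∧
    t = traceNorm (ampliate (Fin n) Φ ρ - ampliate (Fin n) Ψ ρ)}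

end QChannel

/-!
The bound rests on the dual description of the diamond distance (`exists_isChannel_le_add_smul`):
for every `t > ‖Φ - Ψ‖_⋄ / 2` there is a channel `F` with `Φ ≤ Ψ + t F` in the completely positive
order. Given `Λ ≤ Θ⁽¹⁾ + μ₁ F₁` and `Ξ ≤ Θ⁽²⁾ + μ₂ F₂`, the completely positive map
`Θ + μ₁ F₁ ⊗ σ₂ + μ₂ σ₁ ⊗ F₂`, with fixed states `σ₁`, `σ₂`, has marginals that exceed `Λ` and `Ξ`
by completely positive maps of weight `μ₁ + μ₂`. Hence `μ₁ + μ₂` is an admissible noise level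
(`add_mem_noiseLevels`), and letting the `μᵢ` decrease to half the diamond distances gives the
inequality.

For the dual description, maps are replaced by their Choi matrices, and one looks for `Z ≥ 0` with
`Z ≥ choi Φ - choi Ψ` and `Tr_B Z ≤ t`; then `Z + σ ⊗ (t - Tr_B Z)`, for a state `σ`, is the Choi
matrix of `t F`. For a fixed invertible state `ρ` on the input, a `Z` with
`Tr (Tr_B Z · ρ) ≤ ‖Φ - Ψ‖_⋄ / 2` comes from the positive part of the output difference
`(Φ ⊗ id)(ψ) - (Ψ ⊗ id)(ψ)`, where `ψ` is a purification of `ρ` (`exists_dominating_of_isUnit`);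
this difference is traceless, so its positive part has half its trace norm as trace. Singular `ρ`
are reached by perturbation, and Sion's minimax theorem on the compact convex set of states
exchanges the quantifiers (`exists_dominating_traceFst_le`).

The minimum is attained because the Choi matrices of channels form a compact set
(`isCompact_noiseLevels_inter_Iic`).
-/

open scoped Kronecker ComplexOrder

namespace QChannel

/-! ### The trace norm of a Hermitian matrix -/

section TraceNorm

variable {n : Type*} [Fintype n] [DecidableEq n]

theorem traceNorm_nonneg (X : Matrix n n ℂ) : 0 ≤ traceNorm X :=
  Finset.sum_nonneg fun _ _ => Real.sqrt_nonneg _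

theorem exists_unitary_diagonalization {X : Matrix n n ℂ} (hX : X.IsHermitian) :
    ∃ U : Matrix n n ℂ, star U * U = 1 ∧ U * star U = 1 ∧
      X = U * Matrix.diagonal (fun i => (hX.eigenvalues i : ℂ)) * star U := by
  refine ⟨hX.eigenvectorUnitary, Unitary.coe_star_mul_self _, Unitary.coe_mul_star_self _, ?_⟩
  conv_lhs => rw [hX.spectral_theorem, Unitary.conjStarAlgAut_apply]
  rfl

theorem traceNorm_eq_sum_abs_eigenvalues {X : Matrix n n ℂ} (hX : X.IsHermitian) :
    traceNorm X = ∑ i, |hX.eigenvalues i| := by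
  obtain ⟨U, hUU, -, hspec⟩ := exists_unitary_diagonalization hX
  have hsq : X.conjTranspose * X
      = U * Matrix.diagonal (fun i => ((hX.eigenvalues i ^ 2 : ℝ) : ℂ)) * star U := by
    generalize hX.eigenvalues = d at hspec
    rw [hX.eq, hspec]
    calc _ = U * Matrix.diagonal (fun i => (d i : ℂ)) * (star U * U) *
          Matrix.diagonal (fun i => (d i : ℂ)) * star U := by
          simp only [Matrix.mul_assoc]
      _ = _ := by
          rw [hUU, Matrix.mul_one, Matrix.mul_assoc U, Matrix.diagonal_mul_diagonal]
          simp [sq]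
  have hchar : (X.conjTranspose * X).charpoly
      = (Matrix.diagonal (fun i => ((hX.eigenvalues i ^ 2 : ℝ) : ℂ))).charpoly := by
    rw [hsq, Matrix.charpoly_mul_comm, ← Matrix.mul_assoc, hUU, Matrix.one_mul]
  have hroots : (X.conjTranspose * X).charpoly.roots = Multiset.map
      (fun i => ((Matrix.isHermitian_conjTranspose_mul_self X).eigenvalues i : ℂ))
      Finset.univ.val :=
    (Matrix.isHermitian_conjTranspose_mul_self X).roots_charpoly_eq_eigenvalues
  have hroots' : (X.conjTranspose * X).charpoly.roots = Multiset.map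
      (fun i => ((hX.eigenvalues i ^ 2 : ℝ) : ℂ)) Finset.univ.val := by
    rw [hchar, Matrix.charpoly_diagonal]
    refine (congrArg Polynomial.roots (congrArg Multiset.prod
      (Multiset.map_map (fun z : ℂ => Polynomial.X - Polynomial.C z) _ _).symm)).trans
      (Polynomial.roots_multiset_prod_X_sub_C _)
  have h := congrArg (fun s : Multiset ℂ => (s.map fun z => √z.re).sum) (hroots.symm.trans hroots')
  simp only [Multiset.map_map, Function.comp_def, Complex.ofReal_re, Real.sqrt_sq_eq_abs] at h
  exact h

/-- A Hermitian matrix `X` is dominated by its positive part, whose trace is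
`(‖X‖₁ + Tr X) / 2`. -/
theorem exists_posSemidef_trace_eq {X : Matrix n n ℂ} (hX : X.IsHermitian) :
    ∃ Y : Matrix n n ℂ, Y.PosSemidef ∧ (Y - X).PosSemidef ∧
      2 * Y.trace.re = traceNorm X + X.trace.re := by
  obtain ⟨U, hUU, -, hspec⟩ := exists_unitary_diagonalization hX
  rw [traceNorm_eq_sum_abs_eigenvalues hX]
  generalize hX.eigenvalues = d at hspec ⊢
  have hpos : ∀ e : n → ℝ, (∀ i, 0 ≤ e i) →
      (U * Matrix.diagonal (fun i => (e i : ℂ)) * star U).PosSemidef := fun e he =>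
    (Matrix.PosSemidef.diagonal fun i => by simpa using he i).mul_mul_conjTranspose_same U
  have htr : ∀ e : n → ℝ, (U * Matrix.diagonal (fun i => (e i : ℂ)) * star U).trace.re
      = ∑ i, e i := fun e => by
    rw [Matrix.trace_mul_comm, ← Matrix.mul_assoc, hUU, Matrix.one_mul, Matrix.trace_diagonal]
    simp
  refine ⟨U * Matrix.diagonal (fun i => ((max (d i) 0 : ℝ) : ℂ)) * star U,
    hpos _ fun i => le_max_right _ _, ?_, ?_⟩
  · convert hpos (fun i => max (d i) 0 - d i) fun i => sub_nonneg.2 (le_max_left _ _) using 1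
    rw [hspec, ← Matrix.sub_mul, ← Matrix.mul_sub, Matrix.diagonal_sub]
    simp
  · rw [htr, hspec, htr, ← Finset.sum_add_distrib, Finset.mul_sum]
    refine Finset.sum_congr rfl fun i _ => ?_
    rcases le_total 0 (d i) with h | h
    · rw [max_eq_left h, abs_of_nonneg h]; ring
    · rw [max_eq_right h, abs_of_nonpos h]; ring

theorem traceNorm_sub_le {P Q : Matrix n n ℂ} (hP : P.PosSemidef) (hQ : Q.PosSemidef) :
    traceNorm (P - Q) ≤ P.trace.re + Q.trace.re := by
  have hX : (P - Q).IsHermitian := hP.isHermitian.sub hQ.isHermitian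
  obtain ⟨U, hUU, hUU', hspec⟩ := exists_unitary_diagonalization hX
  have hdiag : star U * (P - Q) * U = Matrix.diagonal (fun i => (hX.eigenvalues i : ℂ)) := by
    generalize hX.eigenvalues = d at hspec
    rw [hspec, ← Matrix.mul_assoc, ← Matrix.mul_assoc, hUU, Matrix.one_mul, Matrix.mul_assoc, hUU,
      Matrix.mul_one]
  have htr : ∀ A : Matrix n n ℂ, A.trace.re = ∑ i, ((star U * A * U) i i).re := fun A => by
    rw [← Complex.re_sum]
    congr 1
    change _ = (star U * A * U).trace
    rw [Matrix.trace_mul_comm, ← Matrix.mul_assoc, hUU', Matrix.one_mul]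
  rw [traceNorm_eq_sum_abs_eigenvalues hX, htr P, htr Q, ← Finset.sum_add_distrib]
  refine Finset.sum_le_sum fun i _ => ?_
  have hi : hX.eigenvalues i = ((star U * P * U) i i).re - ((star U * Q * U) i i).re := by
    rw [← Complex.sub_re, ← Matrix.sub_apply, ← Matrix.sub_mul, ← Matrix.mul_sub, hdiag]
    simp
  have h1 : 0 ≤ ((star U * P * U) i i).re :=
    (Complex.le_def.1 (hP.conjTranspose_mul_mul_same U).diag_nonneg).1
  have h2 : 0 ≤ ((star U * Q * U) i i).re :=
    (Complex.le_def.1 (hQ.conjTranspose_mul_mul_same U).diag_nonneg).1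
  rw [hi, abs_le]
  constructor <;> linarith

end TraceNorm

/-! ### Choi matrices -/

section Choi

variable {a b c : Type*}

/-- The Choi matrix `∑ x y, Φ(E_xy) ⊗ E_xy` of `Φ`, with the output system as the first factor. -/
def choi [DecidableEq a] (Φ : Matrix a a ℂ →ₗ[ℂ] Matrix b b ℂ) : Matrix (b × a) (b × a) ℂ :=
  Matrix.of fun p q => Φ (Matrix.single p.2 q.2 1) p.1 q.1

/-- The linear map with a given Choi matrix. -/
def ofChoi [Fintype a] (J : Matrix (b × a) (b × a) ℂ) : Matrix a a ℂ →ₗ[ℂ] Matrix b b ℂ where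
  toFun X := Matrix.of fun i j => ∑ x, ∑ y, X x y * J (i, x) (j, y)
  map_add' X Y := by
    ext i j
    simp [add_mul, Finset.sum_add_distrib]
  map_smul' t X := by
    ext i j
    simp [Finset.mul_sum, mul_assoc]

section

variable [DecidableEq a]

theorem choi_add (Φ Ψ : Matrix a a ℂ →ₗ[ℂ] Matrix b b ℂ) :
    choi (Φ + Ψ) = choi Φ + choi Ψ := rfl

theorem choi_sub (Φ Ψ : Matrix a a ℂ →ₗ[ℂ] Matrix b b ℂ) :
    choi (Φ - Ψ) = choi Φ - choi Ψ := rfl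

theorem choi_smul (t : ℂ) (Φ : Matrix a a ℂ →ₗ[ℂ] Matrix b b ℂ) :
    choi (t • Φ) = t • choi Φ := rfl

variable [Fintype a]

theorem apply_eq_sum_choi (Φ : Matrix a a ℂ →ₗ[ℂ] Matrix b b ℂ) (X : Matrix a a ℂ) (i j : b) :
    Φ X i j = ∑ x, ∑ y, X x y * choi Φ (i, x) (j, y) := by
  conv_lhs => rw [Matrix.matrix_eq_sum_single X]
  simp only [map_sum, Matrix.sum_apply]
  refine Finset.sum_congr rfl fun x _ => Finset.sum_congr rfl fun y _ => ?_
  have h : Matrix.single x y (X x y) = X x y • Matrix.single x y (1 : ℂ) := by simp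
  rw [h, map_smul]
  rfl

theorem ofChoi_choi (Φ : Matrix a a ℂ →ₗ[ℂ] Matrix b b ℂ) : ofChoi (choi Φ) = Φ := by
  ext1 X
  ext i j
  exact (apply_eq_sum_choi Φ X i j).symm

theorem choi_ofChoi (J : Matrix (b × a) (b × a) ℂ) : choi (ofChoi J) = J := by
  ext ⟨i, x⟩ ⟨j, y⟩
  simp [choi, ofChoi, Matrix.single_apply, ite_and]

theorem choi_injective :
    Function.Injective (choi : (Matrix a a ℂ →ₗ[ℂ] Matrix b b ℂ) → Matrix (b × a) (b × a) ℂ) :=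
  Function.LeftInverse.injective ofChoi_choi

theorem ampliate_apply_eq_sum_choi (Φ : Matrix a a ℂ →ₗ[ℂ] Matrix b b ℂ)
    (M : Matrix (a × c) (a × c) ℂ) (p q : b × c) :
    ampliate c Φ M p q = ∑ x, ∑ y, M (x, p.2) (y, q.2) * choi Φ (p.1, x) (q.1, y) :=
  apply_eq_sum_choi Φ _ _ _

theorem trace_apply_eq_sum_choi [Fintype b] (Φ : Matrix a a ℂ →ₗ[ℂ] Matrix b b ℂ)
    (X : Matrix a a ℂ) :
    (Φ X).trace = ∑ x, ∑ y, X x y * traceFst b a (choi Φ) x y := by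
  simp only [Matrix.trace, Matrix.diag_apply, apply_eq_sum_choi Φ X, traceFst, LinearMap.coe_mk,
    AddHom.coe_mk, Matrix.of_apply, Finset.mul_sum]
  rw [Finset.sum_comm]
  refine Finset.sum_congr rfl fun x _ => Finset.sum_comm

theorem trace_apply_eq_of_traceFst_choi [Fintype b] {Φ : Matrix a a ℂ →ₗ[ℂ] Matrix b b ℂ} {t : ℂ}
    (h : traceFst b a (choi Φ) = t • 1) (X : Matrix a a ℂ) : (Φ X).trace = t * X.trace := by
  rw [trace_apply_eq_sum_choi, h]
  simp [Matrix.one_apply, Matrix.trace, Finset.mul_sum, mul_comm]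

theorem traceFst_choi_eq_one_iff [Fintype b] {Φ : Matrix a a ℂ →ₗ[ℂ] Matrix b b ℂ} :
    traceFst b a (choi Φ) = 1 ↔ ∀ X : Matrix a a ℂ, (Φ X).trace = X.trace := by
  refine ⟨fun h X => ?_, fun h => ?_⟩
  · rw [trace_apply_eq_of_traceFst_choi (t := 1) (by rw [h, one_smul]), one_mul]
  · ext x y
    have h' := h (Matrix.single x y 1)
    change (Φ (Matrix.single x y 1)).trace = _
    rw [h']
    by_cases hxy : x = y
    · subst hxy; simp
    · simp [hxy, Matrix.trace_single_eq_of_ne]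

/-- `Φ ⊗ id` applied to `M` is a compression of `choi Φ ⊗ M`. -/
theorem posSemidef_ampliate [Fintype b] [Fintype c] {Φ : Matrix a a ℂ →ₗ[ℂ] Matrix b b ℂ}
    (hΦ : (choi Φ).PosSemidef) {M : Matrix (a × c) (a × c) ℂ} (hM : M.PosSemidef) :
    (ampliate c Φ M).PosSemidef := by
  classical
  let V : Matrix ((b × a) × (a × c)) (b × c) ℂ := Matrix.of fun s p =>
    if s.1.1 = p.1 then if s.2.2 = p.2 then if s.1.2 = s.2.1 then 1 else 0 else 0 else 0
  have h : ampliate c Φ M = V.conjTranspose * (choi Φ ⊗ₖ M) * V := by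
    ext p q
    rw [ampliate_apply_eq_sum_choi, Matrix.mul_assoc]
    simp [Matrix.mul_apply, Fintype.sum_prod_type, V, Matrix.conjTranspose_apply, apply_ite,
      Finset.sum_ite_eq, Finset.sum_ite_irrel, mul_comm]
  rw [h]
  exact (hΦ.kronecker hM).conjTranspose_mul_mul_same V

theorem isChannel_iff_choi [Fintype b] {Φ : Matrix a a ℂ →ₗ[ℂ] Matrix b b ℂ} :
    IsChannel Φ ↔ (choi Φ).PosSemidef ∧ traceFst b a (choi Φ) = 1 := by
  refine ⟨fun h => ⟨?_, traceFst_choi_eq_one_iff.2 h.tracePreserving⟩, fun h =>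
    ⟨fun n M hM => posSemidef_ampliate h.1 hM, traceFst_choi_eq_one_iff.1 h.2⟩⟩
  -- The Choi matrix is the image of the unnormalised maximally entangled state.
  let e := Fintype.equivFin a
  let v : a × Fin (Fintype.card a) → ℂ := fun p => if e p.1 = p.2 then 1 else 0
  have hpsd := (h.completelyPositive _ _ (Matrix.posSemidef_vecMulVec_self_star v)).submatrix
    (Prod.map id e : b × a → b × Fin (Fintype.card a))
  convert hpsd using 1
  ext p q
  have hE : (Matrix.of fun x y => Matrix.vecMulVec v (star v) (x, e p.2) (y, e q.2))
      = Matrix.single p.2 q.2 (1 : ℂ) := by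
    ext x y
    simp only [v, Matrix.of_apply, Matrix.vecMulVec_apply, Matrix.single_apply, Pi.star_apply,
      e.apply_eq_iff_eq, eq_comm (a := x), eq_comm (a := y), ite_and]
    split_ifs <;> simp
  simp [ampliate, choi, hE]

end

end Choi

/-! ### Constructions of channels -/

section Channels

variable {a b c : Type*}

theorem IsChannel.nonempty [Fintype a] [Fintype b] [Nonempty a]
    {Φ : Matrix a a ℂ →ₗ[ℂ] Matrix b b ℂ} (hΦ : IsChannel Φ) : Nonempty b := by
  classical
  by_contra hb
  rw [not_nonempty_iff] at hb
  have h := hΦ.tracePreserving 1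
  rw [Matrix.trace_one] at h
  simp [Matrix.trace, eq_comm] at h

/-- The map `X ↦ Φ X ⊗ σ`. -/
def tensorRight (Φ : Matrix a a ℂ →ₗ[ℂ] Matrix b b ℂ) (σ : Matrix c c ℂ) :
    Matrix a a ℂ →ₗ[ℂ] Matrix (b × c) (b × c) ℂ where
  toFun X := Φ X ⊗ₖ σ
  map_add' X Y := by rw [map_add, Matrix.add_kronecker]
  map_smul' t X := by rw [map_smul, Matrix.smul_kronecker, RingHom.id_apply]

/-- The map `X ↦ σ ⊗ Φ X`. -/
def tensorLeft (σ : Matrix b b ℂ) (Φ : Matrix a a ℂ →ₗ[ℂ] Matrix c c ℂ) :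
    Matrix a a ℂ →ₗ[ℂ] Matrix (b × c) (b × c) ℂ where
  toFun X := σ ⊗ₖ Φ X
  map_add' X Y := by rw [map_add, Matrix.kronecker_add]
  map_smul' t X := by rw [map_smul, Matrix.kronecker_smul, RingHom.id_apply]

/-- The map `X ↦ Tr(X) σ`, which discards the input and prepares `σ`. -/
def prepare (a : Type*) [Fintype a] (σ : Matrix b b ℂ) : Matrix a a ℂ →ₗ[ℂ] Matrix b b ℂ :=
  (Matrix.traceLinearMap a ℂ ℂ).smulRight σ

theorem traceSnd_comp_tensorRight [Fintype c] (Φ : Matrix a a ℂ →ₗ[ℂ] Matrix b b ℂ)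
    {σ : Matrix c c ℂ} (hσ : σ.trace = 1) : traceSnd b c ∘ₗ tensorRight Φ σ = Φ := by
  ext1 X
  ext i j
  have h : ∑ k, Φ X i j * σ k k = Φ X i j := by
    rw [← Finset.mul_sum]
    exact (congrArg _ hσ).trans (mul_one _)
  exact h

theorem traceFst_comp_tensorRight [Fintype a] [Fintype b] {Φ : Matrix a a ℂ →ₗ[ℂ] Matrix b b ℂ}
    (hΦ : ∀ X, (Φ X).trace = X.trace) (σ : Matrix c c ℂ) :
    traceFst b c ∘ₗ tensorRight Φ σ = prepare a σ := by
  ext1 X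
  ext i j
  have h : ∑ k, Φ X k k * σ i j = X.trace * σ i j := by
    rw [← Finset.sum_mul, ← hΦ X]
    rfl
  exact h

theorem traceSnd_comp_tensorLeft [Fintype a] [Fintype c] (σ : Matrix b b ℂ)
    {Φ : Matrix a a ℂ →ₗ[ℂ] Matrix c c ℂ}
    (hΦ : ∀ X, (Φ X).trace = X.trace) : traceSnd b c ∘ₗ tensorLeft σ Φ = prepare a σ := by
  ext1 X
  ext i j
  have h : ∑ k, σ i j * Φ X k k = X.trace * σ i j := by
    rw [← Finset.mul_sum, ← hΦ X, mul_comm]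
    rfl
  exact h

theorem traceFst_comp_tensorLeft [Fintype b] {σ : Matrix b b ℂ} (hσ : σ.trace = 1)
    (Φ : Matrix a a ℂ →ₗ[ℂ] Matrix c c ℂ) : traceFst b c ∘ₗ tensorLeft σ Φ = Φ := by
  ext1 X
  ext i j
  have h : ∑ k, σ k k * Φ X i j = Φ X i j := by
    rw [← Finset.sum_mul]
    exact (congrArg (· * _) hσ).trans (one_mul _)
  exact h

theorem trace_traceSnd [Fintype b] [Fintype c] (M : Matrix (b × c) (b × c) ℂ) :
    (traceSnd b c M).trace = M.trace := by
  simp [traceSnd, Matrix.trace, Fintype.sum_prod_type]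

theorem trace_traceFst [Fintype b] [Fintype c] (M : Matrix (b × c) (b × c) ℂ) :
    (traceFst b c M).trace = M.trace := by
  simp [traceFst, Matrix.trace, Fintype.sum_prod_type_right]

theorem exists_isState (b : Type*) [Fintype b] [Nonempty b] : ∃ σ : Matrix b b ℂ, IsState σ := by
  classical
  obtain ⟨i⟩ := ‹Nonempty b›
  refine ⟨Matrix.diagonal (Pi.single i 1), Matrix.PosSemidef.diagonal ?_, ?_⟩
  · exact Pi.single_nonneg.2 zero_le_one
  · simp [Matrix.trace_diagonal]

section

variable [Fintype a] [Fintype b] [Fintype c] [DecidableEq a]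

/-- A completely positive map that scales the trace by `t > 0` is `t` times a channel. -/
theorem exists_isChannel_smul_eq {Φ : Matrix a a ℂ →ₗ[ℂ] Matrix b b ℂ}
    (hΦ : (choi Φ).PosSemidef) {t : ℝ} (ht : 0 < t)
    (htr : ∀ X, (Φ X).trace = t * X.trace) :
    ∃ N : Matrix a a ℂ →ₗ[ℂ] Matrix b b ℂ, IsChannel N ∧ (t : ℂ) • N = Φ := by
  have ht' : (t : ℂ) ≠ 0 := by exact_mod_cast ht.ne'
  refine ⟨(t : ℂ)⁻¹ • Φ, isChannel_iff_choi.2 ⟨?_, traceFst_choi_eq_one_iff.2 fun X => ?_⟩, ?_⟩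
  · rw [choi_smul]
    refine hΦ.smul ?_
    rw [← Complex.ofReal_inv]
    exact_mod_cast (inv_pos.2 ht).le
  · simp [htr, ht']
  · rw [smul_smul, mul_inv_cancel₀ ht', one_smul]

theorem posSemidef_choi_tensorRight {Φ : Matrix a a ℂ →ₗ[ℂ] Matrix b b ℂ} {σ : Matrix c c ℂ}
    (hΦ : (choi Φ).PosSemidef) (hσ : σ.PosSemidef) : (choi (tensorRight Φ σ)).PosSemidef :=
  (hΦ.kronecker hσ).submatrix fun p : (b × c) × a => ((p.1.1, p.2), p.1.2)

theorem posSemidef_choi_tensorLeft {σ : Matrix b b ℂ} {Φ : Matrix a a ℂ →ₗ[ℂ] Matrix c c ℂ}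
    (hσ : σ.PosSemidef) (hΦ : (choi Φ).PosSemidef) : (choi (tensorLeft σ Φ)).PosSemidef :=
  (hσ.kronecker hΦ).submatrix fun p : (b × c) × a => (p.1.1, (p.1.2, p.2))

theorem posSemidef_choi_prepare {σ : Matrix b b ℂ} (hσ : σ.PosSemidef) :
    (choi (prepare a σ)).PosSemidef := by
  have h : choi (prepare a σ) = σ ⊗ₖ (1 : Matrix a a ℂ) := by
    ext p q
    by_cases hpq : p.2 = q.2
    · simp [choi, prepare, Matrix.one_apply, hpq]
    · simp [choi, prepare, hpq, Matrix.trace_single_eq_of_ne]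
  rw [h]
  exact hσ.kronecker Matrix.PosSemidef.one

omit [Fintype a] [Fintype b] in
theorem choi_traceSnd_comp (Θ : Matrix a a ℂ →ₗ[ℂ] Matrix (b × c) (b × c) ℂ) :
    choi (traceSnd b c ∘ₗ Θ) = ∑ k, (choi Θ).submatrix
      (fun p : b × a => ((p.1, k), p.2)) (fun p : b × a => ((p.1, k), p.2)) := by
  ext p q
  rw [Matrix.sum_apply]
  rfl

omit [Fintype a] [Fintype c] in
theorem choi_traceFst_comp (Θ : Matrix a a ℂ →ₗ[ℂ] Matrix (b × c) (b × c) ℂ) :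
    choi (traceFst b c ∘ₗ Θ) = ∑ k, (choi Θ).submatrix
      (fun p : c × a => ((k, p.1), p.2)) (fun p : c × a => ((k, p.1), p.2)) := by
  ext p q
  rw [Matrix.sum_apply]
  rfl

theorem IsChannel.traceSnd_comp {Θ : Matrix a a ℂ →ₗ[ℂ] Matrix (b × c) (b × c) ℂ}
    (hΘ : IsChannel Θ) : IsChannel (traceSnd b c ∘ₗ Θ) := by
  refine isChannel_iff_choi.2 ⟨?_, traceFst_choi_eq_one_iff.2 fun X =>
    (trace_traceSnd _).trans (hΘ.tracePreserving X)⟩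
  rw [choi_traceSnd_comp]
  exact Matrix.posSemidef_sum _ fun k _ => (isChannel_iff_choi.1 hΘ).1.submatrix _

theorem IsChannel.traceFst_comp {Θ : Matrix a a ℂ →ₗ[ℂ] Matrix (b × c) (b × c) ℂ}
    (hΘ : IsChannel Θ) : IsChannel (traceFst b c ∘ₗ Θ) := by
  refine isChannel_iff_choi.2 ⟨?_, traceFst_choi_eq_one_iff.2 fun X =>
    (trace_traceFst _).trans (hΘ.tracePreserving X)⟩
  rw [choi_traceFst_comp]
  exact Matrix.posSemidef_sum _ fun k _ => (isChannel_iff_choi.1 hΘ).1.submatrix _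

/-- If `Λ ≤ Θ⁽¹⁾ + μ₁ F₁` and `Ξ ≤ Θ⁽²⁾ + μ₂ F₂` in the completely positive order, then the
normalisation of `Θ + μ₁ F₁ ⊗ σ₂ + μ₂ σ₁ ⊗ F₂`, for any states `σ₁`, `σ₂`, is a joint channel of
noisy versions of `Λ` and `Ξ`. -/
theorem add_mem_noiseLevels [Nonempty b] [Nonempty c]
    {Λ F₁ : Matrix a a ℂ →ₗ[ℂ] Matrix b b ℂ} {Ξ F₂ : Matrix a a ℂ →ₗ[ℂ] Matrix c c ℂ}
    {Θ : Matrix a a ℂ →ₗ[ℂ] Matrix (b × c) (b × c) ℂ} {μ₁ μ₂ : ℝ}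
    (hΛ : IsChannel Λ) (hΞ : IsChannel Ξ) (hΘ : IsChannel Θ) (hF₁ : IsChannel F₁)
    (hF₂ : IsChannel F₂) (hμ₁ : 0 < μ₁) (hμ₂ : 0 < μ₂)
    (h₁ : (choi (traceSnd b c ∘ₗ Θ + (μ₁ : ℂ) • F₁ - Λ)).PosSemidef)
    (h₂ : (choi (traceFst b c ∘ₗ Θ + (μ₂ : ℂ) • F₂ - Ξ)).PosSemidef) :
    μ₁ + μ₂ ∈ noiseLevels Λ Ξ := by
  obtain ⟨σ₁, hσ₁, hσ₁'⟩ := exists_isState b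
  obtain ⟨σ₂, hσ₂, hσ₂'⟩ := exists_isState c
  have hμ₁' : (0 : ℂ) ≤ μ₁ := by exact_mod_cast hμ₁.le
  have hμ₂' : (0 : ℂ) ≤ μ₂ := by exact_mod_cast hμ₂.le
  have htΘ₁ := hΘ.traceSnd_comp.tracePreserving
  have htΘ₂ := hΘ.traceFst_comp.tracePreserving
  obtain ⟨N₁, hN₁, hN₁'⟩ := exists_isChannel_smul_eq (t := μ₁ + μ₂)
    (Φ := (traceSnd b c ∘ₗ Θ + (μ₁ : ℂ) • F₁ - Λ) + (μ₂ : ℂ) • prepare a σ₁)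
    (h₁.add ((posSemidef_choi_prepare hσ₁).smul hμ₂')) (by positivity) (fun X => by
      simp only [LinearMap.add_apply, LinearMap.sub_apply, LinearMap.smul_apply, Matrix.trace_add,
        Matrix.trace_sub, Matrix.trace_smul, htΘ₁, hF₁.tracePreserving, hΛ.tracePreserving]
      simp [prepare, hσ₁']
      ring)
  obtain ⟨N₂, hN₂, hN₂'⟩ := exists_isChannel_smul_eq (t := μ₁ + μ₂)
    (Φ := (traceFst b c ∘ₗ Θ + (μ₂ : ℂ) • F₂ - Ξ) + (μ₁ : ℂ) • prepare a σ₂)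
    (h₂.add ((posSemidef_choi_prepare hσ₂).smul hμ₁')) (by positivity) (fun X => by
      simp only [LinearMap.add_apply, LinearMap.sub_apply, LinearMap.smul_apply, Matrix.trace_add,
        Matrix.trace_sub, Matrix.trace_smul, htΘ₂, hF₂.tracePreserving, hΞ.tracePreserving]
      simp [prepare, hσ₂']
      ring)
  obtain ⟨J, hJ, hJ'⟩ := exists_isChannel_smul_eq (t := 1 + (μ₁ + μ₂))
    (Φ := Θ + (μ₁ : ℂ) • tensorRight F₁ σ₂ + (μ₂ : ℂ) • tensorLeft σ₁ F₂)
    (((isChannel_iff_choi.1 hΘ).1.add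
      ((posSemidef_choi_tensorRight (isChannel_iff_choi.1 hF₁).1 hσ₂).smul hμ₁')).add
      ((posSemidef_choi_tensorLeft hσ₁ (isChannel_iff_choi.1 hF₂).1).smul hμ₂'))
    (by positivity) (fun X => by
      have e₁ : (tensorRight F₁ σ₂ X).trace = X.trace := by
        simp [tensorRight, Matrix.trace_kronecker, hσ₂', hF₁.tracePreserving]
      have e₂ : (tensorLeft σ₁ F₂ X).trace = X.trace := by
        simp [tensorLeft, Matrix.trace_kronecker, hσ₁', hF₂.tracePreserving]
      simp only [LinearMap.add_apply, LinearMap.smul_apply, Matrix.trace_add, Matrix.trace_smul,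
        hΘ.tracePreserving, e₁, e₂]
      simp
      ring)
  have hne : (1 + ((μ₁ + μ₂ : ℝ) : ℂ)) ≠ 0 := by
    have : (1 + (μ₁ + μ₂) : ℝ) ≠ 0 := by positivity
    exact_mod_cast this
  have hJ'' : (1 + ((μ₁ + μ₂ : ℝ) : ℂ)) • J
      = Θ + (μ₁ : ℂ) • tensorRight F₁ σ₂ + (μ₂ : ℂ) • tensorLeft σ₁ F₂ := by
    rw [← hJ']
    simp
  refine ⟨by positivity, N₁, N₂, hN₁, hN₂, J, hJ, ?_, ?_⟩
  · rw [eq_inv_smul_iff₀ hne, ← LinearMap.comp_smul, hJ'', hN₁']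
    simp only [LinearMap.comp_add, LinearMap.comp_smul, traceSnd_comp_tensorRight _ hσ₂',
      traceSnd_comp_tensorLeft σ₁ hF₂.tracePreserving]
    abel
  · rw [eq_inv_smul_iff₀ hne, ← LinearMap.comp_smul, hJ'', hN₂']
    simp only [LinearMap.comp_add, LinearMap.comp_smul, traceFst_comp_tensorLeft hσ₁',
      traceFst_comp_tensorRight hF₁.tracePreserving]
    abel

end

end Channels

/-! ### Compactness -/

section Compactness

open scoped MatrixOrder in
/-- The image of a Frobenius sphere under `B ↦ Bᴴ B`. -/
theorem isCompact_setOf_posSemidef_trace_eq (n : Type*) [Fintype n] (t : ℝ) :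
    IsCompact {J : Matrix n n ℂ | J.PosSemidef ∧ J.trace = t} := by
  classical
  have htr : ∀ B : Matrix n n ℂ, (B.conjTranspose * B).trace
      = ((∑ i, ∑ j, ‖B j i‖ ^ 2 : ℝ) : ℂ) := fun B => by
    simp [Matrix.trace, Matrix.mul_apply, Complex.conj_mul']
  have himage : {J : Matrix n n ℂ | J.PosSemidef ∧ J.trace = t}
      = (fun B : Matrix n n ℂ => B.conjTranspose * B) ''
        {B | (B.conjTranspose * B).trace = t} := by
    ext J
    constructor
    · rintro ⟨hJ, hJt⟩
      obtain ⟨B, rfl⟩ := CStarAlgebra.nonneg_iff_eq_star_mul_self.mp hJ.nonneg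
      exact ⟨B, hJt, rfl⟩
    · rintro ⟨B, hB, rfl⟩
      exact ⟨Matrix.posSemidef_conjTranspose_mul_self B, hB⟩
  rw [himage]
  refine IsCompact.image ?_ (by fun_prop)
  have hcpt : IsCompact (Set.pi Set.univ fun _ : n => Set.pi Set.univ fun _ : n =>
      Metric.closedBall (0 : ℂ) (√t)) :=
    isCompact_univ_pi fun _ => isCompact_univ_pi fun _ => isCompact_closedBall _ _
  refine hcpt.of_isClosed_subset
    (isClosed_eq (f := fun B : Matrix n n ℂ => (B.conjTranspose * B).trace) (by fun_prop)
      continuous_const) fun B hB j _ i _ => ?_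
  have hB' : ∑ i, ∑ j, ‖B j i‖ ^ 2 = t := by exact_mod_cast (htr B).symm.trans hB
  rw [mem_closedBall_zero_iff]
  refine Real.le_sqrt_of_sq_le (le_trans ?_ hB'.le)
  exact (Finset.single_le_sum (f := fun j => ‖B j i‖ ^ 2) (fun _ _ => by positivity)
    (Finset.mem_univ j)).trans
    (Finset.single_le_sum (f := fun i => ∑ j, ‖B j i‖ ^ 2) (fun _ _ => by positivity)
      (Finset.mem_univ i))

variable {a b c : Type*} [Fintype a] [Fintype b] [Fintype c] [DecidableEq a]

theorem isCompact_setOf_choi_isChannel (a b : Type*) [Fintype a] [Fintype b] [DecidableEq a] :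
    IsCompact {J : Matrix (b × a) (b × a) ℂ | J.PosSemidef ∧ traceFst b a J = 1} := by
  have hcl : IsClosed {J : Matrix (b × a) (b × a) ℂ | traceFst b a J = 1} :=
    isClosed_eq (LinearMap.continuous_of_finiteDimensional _) continuous_const
  convert (isCompact_setOf_posSemidef_trace_eq (b × a) (Fintype.card a)).inter_right hcl using 1
  ext J
  refine ⟨fun h => ⟨⟨h.1, ?_⟩, h.2⟩, fun h => ⟨h.1.1, h.2⟩⟩
  rw [← trace_traceFst, h.2]
  simp

theorem isCompact_noiseLevels_inter_Iic (Λ : Matrix a a ℂ →ₗ[ℂ] Matrix b b ℂ)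
    (Ξ : Matrix a a ℂ →ₗ[ℂ] Matrix c c ℂ) (R : ℝ) :
    IsCompact (noiseLevels Λ Ξ ∩ Set.Iic R) := by
  let E : Set (ℝ × Matrix (b × a) (b × a) ℂ × Matrix (c × a) (c × a) ℂ ×
      Matrix ((b × c) × a) ((b × c) × a) ℂ) :=
    {x | choi Λ + (x.1 : ℂ) • x.2.1 = (1 + x.1 : ℂ) • ∑ k, x.2.2.2.submatrix
        (fun p : b × a => ((p.1, k), p.2)) (fun p : b × a => ((p.1, k), p.2)) ∧
      choi Ξ + (x.1 : ℂ) • x.2.2.1 = (1 + x.1 : ℂ) • ∑ k, x.2.2.2.submatrix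
        (fun p : c × a => ((k, p.1), p.2)) (fun p : c × a => ((k, p.1), p.2))}
  have hE : IsClosed E :=
    (isClosed_eq (by fun_prop) (by fun_prop)).inter (isClosed_eq (by fun_prop) (by fun_prop))
  have hcpt := ((isCompact_Icc (a := (0 : ℝ)) (b := R)).prod
    ((isCompact_setOf_choi_isChannel a b).prod ((isCompact_setOf_choi_isChannel a c).prod
      (isCompact_setOf_choi_isChannel a (b × c))))).inter_right hE
  convert hcpt.image continuous_fst using 1
  have hne : ∀ r : ℝ, 0 ≤ r → (1 + r : ℂ) ≠ 0 := fun r hr => by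
    have : 1 + r ≠ 0 := by positivity
    exact_mod_cast this
  ext r
  constructor
  · rintro ⟨⟨hr, N₁, N₂, hN₁, hN₂, Θ, hΘ, h₁, h₂⟩, hrR⟩
    refine ⟨(r, choi N₁, choi N₂, choi Θ), ⟨⟨⟨hr, hrR⟩, isChannel_iff_choi.1 hN₁,
      isChannel_iff_choi.1 hN₂, isChannel_iff_choi.1 hΘ⟩, ?_, ?_⟩, rfl⟩
    · rw [eq_inv_smul_iff₀ (hne r hr)] at h₁
      exact (congrArg choi h₁.symm).trans
        (congrArg ((1 + r : ℂ) • ·) (choi_traceSnd_comp Θ))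
    · rw [eq_inv_smul_iff₀ (hne r hr)] at h₂
      exact (congrArg choi h₂.symm).trans
        (congrArg ((1 + r : ℂ) • ·) (choi_traceFst_comp Θ))
  · rintro ⟨⟨r, J₁, J₂, J⟩, ⟨⟨⟨hr, hrR⟩, hJ₁, hJ₂, hJ⟩, h₁, h₂⟩, rfl⟩
    refine ⟨⟨hr, ofChoi J₁, ofChoi J₂, isChannel_iff_choi.2 ?_, isChannel_iff_choi.2 ?_, ofChoi J,
      isChannel_iff_choi.2 ?_, ?_, ?_⟩, hrR⟩
    · rwa [choi_ofChoi]
    · rwa [choi_ofChoi]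
    · rwa [choi_ofChoi]
    · rw [eq_inv_smul_iff₀ (hne r hr)]
      apply choi_injective
      rw [choi_smul, choi_traceSnd_comp, choi_add, choi_smul, choi_ofChoi, choi_ofChoi]
      exact h₁.symm
    · rw [eq_inv_smul_iff₀ (hne r hr)]
      apply choi_injective
      rw [choi_smul, choi_traceFst_comp, choi_add, choi_smul, choi_ofChoi, choi_ofChoi]
      exact h₂.symm

end Compactness

/-! ### Duality for the diamond distance -/

section Duality

variable {a b c : Type*} [Fintype a] [Fintype b] [Fintype c] [DecidableEq a]

omit [DecidableEq a] in
theorem trace_ampliate {Φ : Matrix a a ℂ →ₗ[ℂ] Matrix b b ℂ}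
    (hΦ : ∀ X, (Φ X).trace = X.trace) (M : Matrix (a × c) (a × c) ℂ) :
    (ampliate c Φ M).trace = M.trace := by
  calc (ampliate c Φ M).trace
      = ∑ k, (Φ (Matrix.of fun x y => M (x, k) (y, k))).trace := by
        rw [Matrix.trace, Fintype.sum_prod_type_right]
        rfl
    _ = ∑ k, ∑ x, M (x, k) (x, k) := Finset.sum_congr rfl fun k _ => hΦ _
    _ = M.trace := by
        rw [Matrix.trace, Fintype.sum_prod_type_right]
        rfl

omit [DecidableEq a] in
theorem diamondDist_nonneg [DecidableEq b] (Φ Ψ : Matrix a a ℂ →ₗ[ℂ] Matrix b b ℂ) :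
    0 ≤ diamondDist Φ Ψ :=
  Real.sSup_nonneg fun _ ⟨_, _, _, ht⟩ => ht ▸ traceNorm_nonneg _

omit [DecidableEq a] in
theorem traceNorm_ampliate_sub_le_diamondDist [DecidableEq b]
    {Φ Ψ : Matrix a a ℂ →ₗ[ℂ] Matrix b b ℂ}
    (hΦ : IsChannel Φ) (hΨ : IsChannel Ψ) {n : ℕ} {ρ : Matrix (a × Fin n) (a × Fin n) ℂ}
    (hρ : IsState ρ) :
    traceNorm (ampliate (Fin n) Φ ρ - ampliate (Fin n) Ψ ρ) ≤ diamondDist Φ Ψ := by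
  -- The set of trace norms is bounded by 2, so its `sSup` is a genuine supremum.
  refine le_csSup ⟨2, ?_⟩ ⟨n, ρ, hρ, rfl⟩
  rintro _ ⟨m, τ, hτ, rfl⟩
  refine (traceNorm_sub_le (hΦ.completelyPositive m τ hτ.1)
    (hΨ.completelyPositive m τ hτ.1)).trans ?_
  rw [trace_ampliate hΦ.tracePreserving, trace_ampliate hΨ.tracePreserving, hτ.2]
  norm_num

omit [DecidableEq a] in
theorem trace_mul_one_kronecker [DecidableEq b] (Z : Matrix (b × a) (b × a) ℂ)
    (ρ : Matrix a a ℂ) : (Z * ((1 : Matrix b b ℂ) ⊗ₖ ρ)).trace = (traceFst b a Z * ρ).trace := by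
  simp [Matrix.trace, Matrix.mul_apply, Fintype.sum_prod_type, traceFst, Matrix.one_apply,
    Finset.sum_mul]
  rw [Finset.sum_comm]
  exact Finset.sum_congr rfl fun x _ => Finset.sum_comm

/-- Evaluating the diamond distance at the pure state whose amplitudes are the conjugates of the
entries of `w` gives an operator `Z` with `Z ≥ 0` and `Z ≥ choi Φ - choi Ψ` that satisfies the
bound `Tr (Tr_B Z · ρ) ≤ ‖Φ - Ψ‖_⋄ / 2` for the single state `ρ = w wᴴ`: with `K = 1 ⊗ w`, the
difference of the outputs is `Kᴴ (choi Φ - choi Ψ) K` up to relabelling, and `Z = K⁻ᴴ Y K⁻¹` for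
its positive part `Y`. -/
theorem exists_dominating_of_isUnit [DecidableEq b] {Φ Ψ : Matrix a a ℂ →ₗ[ℂ] Matrix b b ℂ}
    (hΦ : IsChannel Φ) (hΨ : IsChannel Ψ) {w : Matrix a a ℂ} (hw : IsUnit w)
    (hw' : (w * w.conjTranspose).trace = 1) :
    ∃ Z : Matrix (b × a) (b × a) ℂ, Z.PosSemidef ∧ (Z - (choi Φ - choi Ψ)).PosSemidef ∧
      (traceFst b a Z * (w * w.conjTranspose)).trace.re ≤ diamondDist Φ Ψ / 2 := by
  let e := Fintype.equivFin a
  let v : a × Fin (Fintype.card a) → ℂ := fun p => w p.1 (e.symm p.2)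
  let ρ : Matrix (a × Fin (Fintype.card a)) (a × Fin (Fintype.card a)) ℂ :=
    Matrix.vecMulVec (star v) v
  have hρ : IsState ρ := by
    refine ⟨Matrix.posSemidef_vecMulVec_star_self v, ?_⟩
    rw [← hw']
    simp only [Matrix.trace, Matrix.diag_apply, Fintype.sum_prod_type, ρ, v,
      Matrix.vecMulVec_apply, Matrix.mul_apply, Pi.star_apply, Matrix.conjTranspose_apply]
    exact Finset.sum_congr rfl fun x _ =>
      (Equiv.sum_comp e.symm fun y => star (w x y) * w x y).trans
        (Finset.sum_congr rfl fun y _ => mul_comm _ _)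
  let K : Matrix (b × a) (b × a) ℂ := (1 : Matrix b b ℂ) ⊗ₖ w
  let f : b × a → b × Fin (Fintype.card a) := Prod.map id e
  -- The diamond distance ranges over ancillas indexed by `Fin n`, so the second copy of `a` is
  -- relabelled by `e`.
  have hamp : ∀ Γ : Matrix a a ℂ →ₗ[ℂ] Matrix b b ℂ,
      (ampliate (Fin (Fintype.card a)) Γ ρ).submatrix f f = K.conjTranspose * choi Γ * K := by
    intro Γ
    ext p q
    rw [Matrix.submatrix_apply, ampliate_apply_eq_sum_choi]
    simp only [Matrix.mul_apply, Matrix.conjTranspose_apply, Fintype.sum_prod_type, K, ρ, v, f,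
      Matrix.vecMulVec_apply, Matrix.one_apply, Matrix.kroneckerMap_apply, Prod.map, id,
      Pi.star_apply, Equiv.symm_apply_apply, ite_mul, one_mul, zero_mul, apply_ite star, star_zero,
      mul_ite, mul_zero, Finset.sum_ite_irrel, Finset.sum_ite_eq', Finset.sum_const_zero,
      Finset.mem_univ, if_true, Finset.sum_mul]
    rw [Finset.sum_comm]
    exact Finset.sum_congr rfl fun y _ => Finset.sum_congr rfl fun x _ => by ring
  set X := ampliate (Fin (Fintype.card a)) Φ ρ - ampliate (Fin (Fintype.card a)) Ψ ρ with hX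
  have hXherm : X.IsHermitian := ((hΦ.completelyPositive _ ρ hρ.1).isHermitian).sub
    (hΨ.completelyPositive _ ρ hρ.1).isHermitian
  have hXtr : X.trace = 0 := by
    rw [hX, Matrix.trace_sub, trace_ampliate hΦ.tracePreserving,
      trace_ampliate hΨ.tracePreserving, sub_self]
  obtain ⟨Y, hY, hYX, hYtr⟩ := exists_posSemidef_trace_eq hXherm
  have hle := traceNorm_ampliate_sub_le_diamondDist hΦ hΨ hρ
  have hXf : X.submatrix f f = K.conjTranspose * (choi Φ - choi Ψ) * K := by
    rw [Matrix.mul_sub, Matrix.sub_mul, ← hamp, ← hamp]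
    rfl
  have hK : IsUnit K := Matrix.IsUnit.kronecker isUnit_one hw
  have hKdet : IsUnit K.det := (Matrix.isUnit_iff_isUnit_det K).1 hK
  have hKK : K * K⁻¹ = 1 := Matrix.mul_nonsing_inv K hKdet
  have hKK' : K⁻¹ * K = 1 := Matrix.nonsing_inv_mul K hKdet
  have hKH : (K⁻¹).conjTranspose * K.conjTranspose = 1 := by
    rw [← Matrix.conjTranspose_mul, hKK, Matrix.conjTranspose_one]
  have hKH' : K.conjTranspose * (K⁻¹).conjTranspose = 1 := by
    rw [← Matrix.conjTranspose_mul, hKK', Matrix.conjTranspose_one]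
  refine ⟨(K⁻¹).conjTranspose * Y.submatrix f f * K⁻¹,
    (hY.submatrix f).conjTranspose_mul_mul_same _, ?_, ?_⟩
  · have h := (hYX.submatrix f).conjTranspose_mul_mul_same K⁻¹
    have hsub : (Y - X).submatrix f f = Y.submatrix f f
        - K.conjTranspose * (choi Φ - choi Ψ) * K := by
      rw [← hXf]
      rfl
    have hcancel : (K⁻¹).conjTranspose * (K.conjTranspose * (choi Φ - choi Ψ) * K) * K⁻¹
        = choi Φ - choi Ψ := by
      rw [Matrix.mul_assoc, Matrix.mul_assoc, hKK, Matrix.mul_one, ← Matrix.mul_assoc, hKH,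
        Matrix.one_mul]
    rwa [hsub, Matrix.mul_sub, Matrix.sub_mul, hcancel] at h
  · have hKK2 : (1 : Matrix b b ℂ) ⊗ₖ (w * w.conjTranspose) = K * K.conjTranspose := by
      simp only [K, Matrix.conjTranspose_kronecker, Matrix.conjTranspose_one,
        ← Matrix.mul_kronecker_mul, Matrix.one_mul]
    have htr : (Y.submatrix f f).trace = Y.trace := by
      simp only [Matrix.trace, Matrix.diag_apply, Matrix.submatrix_apply]
      exact Equiv.sum_comp (Equiv.prodCongr (Equiv.refl b) e) fun p => Y p p
    rw [← trace_mul_one_kronecker, hKK2, Matrix.mul_assoc, ← Matrix.mul_assoc K⁻¹, hKK',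
      Matrix.one_mul, Matrix.trace_mul_comm, ← Matrix.mul_assoc, hKH', Matrix.one_mul, htr]
    rw [hXtr, Complex.zero_re] at hYtr
    linarith

open scoped MatrixOrder in
theorem exists_isUnit_mul_conjTranspose_eq {ρ : Matrix a a ℂ} (hρ : ρ.PosDef) :
    ∃ w : Matrix a a ℂ, IsUnit w ∧ w * w.conjTranspose = ρ := by
  obtain ⟨B, hB⟩ := CStarAlgebra.nonneg_iff_eq_star_mul_self.mp hρ.posSemidef.nonneg
  refine ⟨star B, ?_, ?_⟩
  · have h := (Matrix.isUnit_iff_isUnit_det _).1 hρ.isUnit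
    rw [hB, Matrix.det_mul] at h
    exact (Matrix.isUnit_iff_isUnit_det _).2 (isUnit_of_mul_isUnit_left h)
  · rw [hB, Matrix.star_eq_conjTranspose, Matrix.conjTranspose_conjTranspose]

omit [Fintype a] [DecidableEq a] in
theorem convex_setOf_posSemidef_sub (D : Matrix a a ℂ) :
    Convex ℝ {Z : Matrix a a ℂ | (Z - D).PosSemidef} := by
  intro Z hZ Z' hZ' s t hs ht hst
  have h := (Matrix.PosSemidef.smul hZ hs).add (Matrix.PosSemidef.smul hZ' ht)
  have e : s • Z + t • Z' - D = s • (Z - D) + t • (Z' - D) := by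
    have : D = (s + t) • D := by rw [hst, one_smul]
    conv_lhs => rw [this]
    module
  change Matrix.PosSemidef (s • Z + t • Z' - D)
  rwa [e]

omit [Fintype a] [DecidableEq a] in
theorem posSemidef_traceFst {Z : Matrix (b × a) (b × a) ℂ} (hZ : Z.PosSemidef) :
    (traceFst b a Z).PosSemidef := by
  have h : traceFst b a Z = ∑ k, Z.submatrix (fun x => (k, x)) (fun x => (k, x)) := by
    ext x y
    rw [Matrix.sum_apply]
    rfl
  rw [h]
  exact Matrix.posSemidef_sum _ fun k _ => hZ.submatrix _

theorem posSemidef_of_trace_mul_state_nonneg {M : Matrix a a ℂ} (hM : M.IsHermitian)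
    (h : ∀ ρ : Matrix a a ℂ, IsState ρ → 0 ≤ (M * ρ).trace.re) : M.PosSemidef := by
  rw [hM.posSemidef_iff_eigenvalues_nonneg]
  intro i
  obtain ⟨U, hUU, -, hspec⟩ := exists_unitary_diagonalization hM
  let P : Matrix a a ℂ := Matrix.diagonal (Pi.single i 1)
  have hP : P.PosSemidef := Matrix.PosSemidef.diagonal (Pi.single_nonneg.2 zero_le_one)
  have hi := h (U * P * star U) ⟨hP.mul_mul_conjTranspose_same U, by
    rw [Matrix.trace_mul_comm, ← Matrix.mul_assoc, hUU, Matrix.one_mul]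
    simp [P, Matrix.trace_diagonal]⟩
  generalize hM.eigenvalues = d at hspec ⊢
  have e : M * (U * P * star U)
      = U * (Matrix.diagonal (fun i => (d i : ℂ)) * P) * star U := by
    calc M * (U * P * star U) = U * Matrix.diagonal (fun i => (d i : ℂ)) * (star U * U) * P *
          star U := by
          rw [hspec]
          simp only [Matrix.mul_assoc]
      _ = _ := by rw [hUU, Matrix.mul_one, Matrix.mul_assoc U]
  rw [e, Matrix.trace_mul_comm, ← Matrix.mul_assoc, hUU, Matrix.one_mul,
    Matrix.diagonal_mul_diagonal, Matrix.trace_diagonal] at hi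
  simpa [Pi.single_apply] using hi

end Duality

section Minimax

variable {a b : Type*} [Fintype a] [Fintype b]

/-- The real-linear functional `X ↦ Re Tr (X ρ)`. -/
def reTraceMul (ρ : Matrix a a ℂ) : Matrix a a ℂ →ₗ[ℝ] ℝ where
  toFun X := (X * ρ).trace.re
  map_add' X Y := by simp [Matrix.add_mul]
  map_smul' t X := by simp

theorem convex_setOf_isState : Convex ℝ {ρ : Matrix a a ℂ | IsState ρ} := by
  intro ρ hρ τ hτ s t hs ht hst
  refine ⟨(hρ.1.smul hs).add (hτ.1.smul ht), ?_⟩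
  rw [Matrix.trace_add, Matrix.trace_smul, Matrix.trace_smul, hρ.2, hτ.2, ← add_smul, hst,
    one_smul]

theorem isCompact_setOf_isState : IsCompact {ρ : Matrix a a ℂ | IsState ρ} := by
  simpa [IsState] using isCompact_setOf_posSemidef_trace_eq a 1

variable [DecidableEq a]

/-- The bound for invertible `ρ = w wᴴ` extends, with an arbitrarily small loss, to singular `ρ` by
mixing with the maximally mixed state. -/
theorem exists_dominating_trace_lt [Nonempty a] {D : Matrix (b × a) (b × a) ℂ} {s t : ℝ}
    (hs : 0 ≤ s) (hst : s < t)
    (h : ∀ w : Matrix a a ℂ, IsUnit w → (w * w.conjTranspose).trace = 1 →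
      ∃ Z : Matrix (b × a) (b × a) ℂ, Z.PosSemidef ∧ (Z - D).PosSemidef ∧
        (traceFst b a Z * (w * w.conjTranspose)).trace.re ≤ s)
    {ρ : Matrix a a ℂ} (hρ : IsState ρ) :
    ∃ Z : Matrix (b × a) (b × a) ℂ, Z.PosSemidef ∧ (Z - D).PosSemidef ∧
      (traceFst b a Z * ρ).trace.re < t := by
  -- With this `δ`, `(1 - δ) t` is the midpoint of `s` and `t`.
  set δ : ℝ := (t - s) / (2 * t) with hδ
  have ht : 0 < t := hs.trans_lt hst
  have hδ0 : 0 < δ := div_pos (sub_pos.2 hst) (by positivity)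
  have hδt : (1 - δ) * t = (s + t) / 2 := by
    rw [hδ]
    field_simp
    ring
  have hδ1 : 0 < 1 - δ := by
    by_contra hneg
    nlinarith
  have hcard : (0 : ℝ) < Fintype.card a := by exact_mod_cast Fintype.card_pos
  have hη : 0 < δ / Fintype.card a := div_pos hδ0 hcard
  have hpd : ((1 - δ) • ρ + (δ / Fintype.card a) • (1 : Matrix a a ℂ)).PosDef :=
    (Matrix.PosDef.one.smul hη).posSemidef_add (hρ.1.smul hδ1.le)
  obtain ⟨w, hw, hwρ⟩ := exists_isUnit_mul_conjTranspose_eq hpd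
  obtain ⟨Z, hZ, hZD, hZs⟩ := h w hw (by
    rw [hwρ, Matrix.trace_add, Matrix.trace_smul, Matrix.trace_smul, hρ.2, Matrix.trace_one]
    have : (Fintype.card a : ℂ) ≠ 0 := by exact_mod_cast hcard.ne'
    simp only [Complex.real_smul]
    push_cast
    field_simp
    ring)
  refine ⟨Z, hZ, hZD, ?_⟩
  have hZ0 : 0 ≤ (traceFst b a Z).trace.re :=
    (Complex.le_def.1 (posSemidef_traceFst hZ).trace_nonneg).1
  rw [hwρ, Matrix.mul_add, Matrix.trace_add, Matrix.mul_smul, Matrix.mul_smul, Matrix.mul_one,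
    Matrix.trace_smul, Matrix.trace_smul, Complex.add_re, Complex.smul_re, Complex.smul_re,
    smul_eq_mul, smul_eq_mul] at hZs
  have h1 : (1 - δ) * (traceFst b a Z * ρ).trace.re < (1 - δ) * t := by
    have := mul_nonneg hη.le hZ0
    linarith
  exact lt_of_mul_lt_mul_left h1 hδ1.le

/-- By Sion's minimax theorem, a single operator `Z` satisfies the bound for all states at once,
which is the operator inequality `Tr_B Z ≤ t`. -/
theorem exists_dominating_traceFst_le [Nonempty a] {D : Matrix (b × a) (b × a) ℂ} {t : ℝ}
    (h : ∀ ρ : Matrix a a ℂ, IsState ρ → ∃ Z : Matrix (b × a) (b × a) ℂ,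
      Z.PosSemidef ∧ (Z - D).PosSemidef ∧ (traceFst b a Z * ρ).trace.re < t) :
    ∃ Z : Matrix (b × a) (b × a) ℂ, Z.PosSemidef ∧ (Z - D).PosSemidef ∧
      ((t : ℂ) • 1 - traceFst b a Z).PosSemidef := by
  let X : Set (Matrix a a ℂ) := {ρ | IsState ρ}
  let Y : Set (Matrix (b × a) (b × a) ℂ) := {Z | Z.PosSemidef ∧ (Z - D).PosSemidef}
  let f : Matrix a a ℂ → Matrix (b × a) (b × a) ℂ → ℝ := fun ρ Z => -(traceFst b a Z * ρ).trace.re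
  have hY : Convex ℝ Y := by
    have h0 := convex_setOf_posSemidef_sub (0 : Matrix (b × a) (b × a) ℂ)
    simp only [sub_zero] at h0
    exact h0.inter (convex_setOf_posSemidef_sub D)
  have hX : Convex ℝ X := convex_setOf_isState
  have hXc : IsCompact X := isCompact_setOf_isState
  have hcont : Continuous (traceFst b a) := LinearMap.continuous_of_finiteDimensional _
  have hfX : ∀ Z, Continuous fun ρ => f ρ Z := fun Z => by fun_prop
  have hfY : ∀ ρ, Continuous fun Z => f ρ Z := fun ρ => by
    have : Continuous fun Z => traceFst b a Z := hcont
    fun_prop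
  have hfX' : ∀ Z, ConvexOn ℝ X fun ρ => f ρ Z := fun Z => by
    have e : (fun ρ => f ρ Z) = -(reTraceMul (traceFst b a Z)) := by
      ext ρ
      simp [f, reTraceMul, Matrix.trace_mul_comm ρ]
    rw [e]
    exact (-(reTraceMul (traceFst b a Z))).convexOn hX
  have hfY' : ∀ ρ, ConcaveOn ℝ Y fun Z => f ρ Z := fun ρ =>
    (-(reTraceMul ρ ∘ₗ (traceFst b a).restrictScalars ℝ)).concaveOn hY
  have hfin : ∃ u : Finset Y, ∀ ρ ∈ X, ∃ Z ∈ u, -t < f ρ Z := by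
    refine (LowerSemicontinuousOn.inter_biInter_preimage_Iic_eq_empty_iff_exists_finset
      (f := fun Z ρ => f ρ Z) hXc fun Z _ =>
        (hfX Z).lowerSemicontinuous.lowerSemicontinuousOn _).1 ?_
    refine Set.eq_empty_of_forall_notMem ?_
    rintro ρ ⟨hρ, hρ'⟩
    obtain ⟨Z, hZ, hZD, hZt⟩ := h ρ hρ
    have h1 : f ρ Z ≤ -t := Set.mem_iInter₂.1 hρ' Z ⟨hZ, hZD⟩
    simp only [f] at h1
    linarith
  obtain ⟨u, hu⟩ := hfin
  obtain ⟨Z, ⟨hZ, hZD⟩, hZt⟩ := Sion.exists_lt_iInf_of_lt_iInf_of_finite (f := f) (t := -t)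
    (exists_isState a) hXc
    (fun Z _ => (hfX Z).lowerSemicontinuous.lowerSemicontinuousOn _)
    (fun Z _ => (hfX' Z).quasiconvexOn) hY
    (fun ρ _ => (hfY ρ).upperSemicontinuous.upperSemicontinuousOn _)
    (fun ρ _ => (hfY' ρ).quasiconcaveOn) hX
    ((Finset.finite_toSet u).image Subtype.val) (Subtype.coe_image_subset Y _)
    (fun ρ hρ => by
      obtain ⟨Z, hZu, hZ⟩ := hu ρ hρ
      exact ⟨Z, ⟨Z, hZu, rfl⟩, hZ⟩)
  refine ⟨Z, hZ, hZD, posSemidef_of_trace_mul_state_nonneg ?_ fun ρ hρ => ?_⟩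
  · refine Matrix.IsHermitian.sub ?_ (posSemidef_traceFst hZ).isHermitian
    simp [Matrix.IsHermitian, Matrix.conjTranspose_smul]
  · have h1 : -t < -(traceFst b a Z * ρ).trace.re := hZt ρ hρ
    rw [Matrix.sub_mul, Matrix.trace_sub, Matrix.smul_mul, Matrix.one_mul, Matrix.trace_smul, hρ.2]
    simp
    linarith

/-- The dual description of the diamond distance: every `t > ‖Φ - Ψ‖_⋄ / 2` admits a channel `F`
with `Φ ≤ Ψ + t F` in the completely positive order. -/
theorem exists_isChannel_le_add_smul [Nonempty a] [DecidableEq b]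
    {Φ Ψ : Matrix a a ℂ →ₗ[ℂ] Matrix b b ℂ}
    (hΦ : IsChannel Φ) (hΨ : IsChannel Ψ) {t : ℝ} (ht : diamondDist Φ Ψ / 2 < t) :
    ∃ F : Matrix a a ℂ →ₗ[ℂ] Matrix b b ℂ, IsChannel F ∧
      (choi (Ψ + (t : ℂ) • F - Φ)).PosSemidef := by
  have hd : 0 ≤ diamondDist Φ Ψ / 2 := div_nonneg (diamondDist_nonneg _ _) zero_le_two
  have : Nonempty b := hΦ.nonempty
  obtain ⟨Z, hZ, hZD, hZt⟩ := exists_dominating_traceFst_le fun ρ hρ =>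
    exists_dominating_trace_lt hd ht (fun w hw hw' => exists_dominating_of_isUnit hΦ hΨ hw hw') hρ
  obtain ⟨σ, hσ, hσ'⟩ := exists_isState b
  -- Adding `σ ⊗ (t - Tr_B Z)` makes the partial trace equal to `t`.
  let Z' := Z + σ ⊗ₖ ((t : ℂ) • 1 - traceFst b a Z)
  have hσZ : (σ ⊗ₖ ((t : ℂ) • 1 - traceFst b a Z)).PosSemidef := hσ.kronecker hZt
  have hZ'tr : traceFst b a Z' = (t : ℂ) • 1 := by
    have h : ∀ G : Matrix a a ℂ, traceFst b a (σ ⊗ₖ G) = G := fun G =>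
      LinearMap.congr_fun (traceFst_comp_tensorLeft hσ' LinearMap.id) G
    rw [map_add, h]
    abel
  obtain ⟨F, hF, hF'⟩ := exists_isChannel_smul_eq (Φ := ofChoi Z') (t := t)
    (by rw [choi_ofChoi]; exact hZ.add hσZ) (hd.trans_lt ht)
    (trace_apply_eq_of_traceFst_choi (by rw [choi_ofChoi, hZ'tr]))
  refine ⟨F, hF, ?_⟩
  have e : choi (Ψ + (t : ℂ) • F - Φ)
      = (Z - (choi Φ - choi Ψ)) + σ ⊗ₖ ((t : ℂ) • 1 - traceFst b a Z) := by
    rw [hF', choi_sub, choi_add, choi_ofChoi]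
    simp only [Z']
    abel
  rw [e]
  exact hZD.add hσZ

end Minimax

/-! ### The robustness of incompatibility -/

section Robustness

variable {a b c : Type*} [Fintype a] [Fintype b] [Fintype c]

/-- The index type `a` may be empty; then no state exists, and every map is the zero map. -/
theorem isChannel_of_isEmpty [IsEmpty a] (Φ : Matrix a a ℂ →ₗ[ℂ] Matrix b b ℂ) : IsChannel Φ := by
  classical
  refine isChannel_iff_choi.2 ⟨?_, Subsingleton.elim _ _⟩
  rw [Subsingleton.elim (choi Φ) 0]
  exact Matrix.PosSemidef.zero

theorem mem_noiseLevels_of_isEmpty [IsEmpty a] (Λ : Matrix a a ℂ →ₗ[ℂ] Matrix b b ℂ)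
    (Ξ : Matrix a a ℂ →ₗ[ℂ] Matrix c c ℂ) {r : ℝ} (hr : 0 ≤ r) : r ∈ noiseLevels Λ Ξ := by
  exact ⟨hr, 0, 0, isChannel_of_isEmpty _, isChannel_of_isEmpty _, 0, isChannel_of_isEmpty _,
    Subsingleton.elim _ _, Subsingleton.elim _ _⟩

theorem isLeast_robustness {Λ : Matrix a a ℂ →ₗ[ℂ] Matrix b b ℂ}
    {Ξ : Matrix a a ℂ →ₗ[ℂ] Matrix c c ℂ} (hne : (noiseLevels Λ Ξ).Nonempty) :
    IsLeast (noiseLevels Λ Ξ) (robustness Λ Ξ) := by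
  classical
  obtain ⟨R, hR⟩ := hne
  obtain ⟨r, ⟨hr, hrR⟩, hmin⟩ :=
    (isCompact_noiseLevels_inter_Iic Λ Ξ R).exists_isLeast ⟨R, hR, Set.self_mem_Iic⟩
  have hleast : IsLeast (noiseLevels Λ Ξ) r := ⟨hr, fun s hs => by
    rcases le_total s R with h | h
    · exact hmin ⟨hs, h⟩
    · exact le_trans hrR h⟩
  rwa [robustness, hleast.csInf_eq]

theorem add_mem_noiseLevels_of_diamondDist_lt [DecidableEq b] [DecidableEq c]
    {Λ : Matrix a a ℂ →ₗ[ℂ] Matrix b b ℂ} {Ξ : Matrix a a ℂ →ₗ[ℂ] Matrix c c ℂ}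
    {Θ : Matrix a a ℂ →ₗ[ℂ] Matrix (b × c) (b × c) ℂ} {μ₁ μ₂ : ℝ}
    (hΛ : IsChannel Λ) (hΞ : IsChannel Ξ) (hΘ : IsChannel Θ)
    (h₁ : diamondDist Λ (traceSnd b c ∘ₗ Θ) / 2 < μ₁)
    (h₂ : diamondDist Ξ (traceFst b c ∘ₗ Θ) / 2 < μ₂) :
    μ₁ + μ₂ ∈ noiseLevels Λ Ξ := by
  classical
  have hμ₁ : 0 < μ₁ := (div_nonneg (diamondDist_nonneg _ _) zero_le_two).trans_lt h₁
  have hμ₂ : 0 < μ₂ := (div_nonneg (diamondDist_nonneg _ _) zero_le_two).trans_lt h₂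
  cases isEmpty_or_nonempty a
  · exact mem_noiseLevels_of_isEmpty Λ Ξ (by positivity)
  · have := hΛ.nonempty
    have := hΞ.nonempty
    obtain ⟨F₁, hF₁, hF₁'⟩ := exists_isChannel_le_add_smul hΛ hΘ.traceSnd_comp h₁
    obtain ⟨F₂, hF₂, hF₂'⟩ := exists_isChannel_le_add_smul hΞ hΘ.traceFst_comp h₂
    exact add_mem_noiseLevels hΛ hΞ hΘ hF₁ hF₂ hμ₁ hμ₂ hF₁' hF₂'

theorem noiseLevels_nonempty {Λ : Matrix a a ℂ →ₗ[ℂ] Matrix b b ℂ}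
    {Ξ : Matrix a a ℂ →ₗ[ℂ] Matrix c c ℂ} (hΛ : IsChannel Λ) (hΞ : IsChannel Ξ) :
    (noiseLevels Λ Ξ).Nonempty := by
  classical
  cases isEmpty_or_nonempty a
  · exact ⟨0, mem_noiseLevels_of_isEmpty Λ Ξ le_rfl⟩
  · have := hΞ.nonempty
    obtain ⟨σ, hσ, hσ'⟩ := exists_isState c
    have hΘ : IsChannel (tensorRight Λ σ) := isChannel_iff_choi.2
      ⟨posSemidef_choi_tensorRight (isChannel_iff_choi.1 hΛ).1 hσ,
        traceFst_choi_eq_one_iff.2 fun X => by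
          simp [tensorRight, Matrix.trace_kronecker, hσ', hΛ.tracePreserving]⟩
    exact ⟨_, add_mem_noiseLevels_of_diamondDist_lt hΛ hΞ hΘ (lt_add_one _) (lt_add_one _)⟩

end Robustness

end QChannel

theorem theorem1 {a b₁ b₂ : Type*} [Fintype a] [Fintype b₁] [Fintype b₂]
    [DecidableEq b₁] [DecidableEq b₂]
    (Λ : Matrix a a ℂ →ₗ[ℂ] Matrix b₁ b₁ ℂ) (Ξ : Matrix a a ℂ →ₗ[ℂ] Matrix b₂ b₂ ℂ)
    (hΛ : QChannel.IsChannel Λ) (hΞ : QChannel.IsChannel Ξ) :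
    IsLeast (QChannel.noiseLevels Λ Ξ) (QChannel.robustness Λ Ξ) ∧
      ∀ Θ : Matrix a a ℂ →ₗ[ℂ] Matrix (b₁ × b₂) (b₁ × b₂) ℂ, QChannel.IsChannel Θ →
        2 * QChannel.robustness Λ Ξ ≤
          QChannel.diamondDist Λ (QChannel.traceSnd b₁ b₂ ∘ₗ Θ) +
            QChannel.diamondDist Ξ (QChannel.traceFst b₁ b₂ ∘ₗ Θ) := by
  have hleast := QChannel.isLeast_robustness (QChannel.noiseLevels_nonempty hΛ hΞ)
  refine ⟨hleast, fun Θ hΘ => le_of_forall_pos_le_add fun ε hε => ?_⟩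
  have h := hleast.2 (QChannel.add_mem_noiseLevels_of_diamondDist_lt hΛ hΞ hΘ
    (lt_add_of_pos_right _ (show 0 < ε / 4 by positivity))
    (lt_add_of_pos_right _ (show 0 < ε / 4 by positivity)))
  linarith
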